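/- Let $(M,g)$ be a smooth ($C^\infty$) finite-dimensional Riemannian manifold without boundary, and let $f\in C^\infty(M)$ satisfy $\|\operatorname{grad} f\|<1$ on $M$, so that $\tilde g=g-df\otimes df$ is again a Riemannian metric on $M$. Here $\operatorname{grad}$, $\|\cdot\|$, the Hessian $\operatorname{Hess}_f=\nabla df$ and the Laplacian $\Delta f=\operatorname{trace}_g\operatorname{Hess}_f$ are taken with respect to $g$. For a smooth map $\varphi:(M_1,g_1)\to(M_2,g_2)$ of Riemannian manifolds let $\tau(\varphi)=\operatorname{trace}_{g_1}\nabla d\varphi$ be its tension field, where $(\nabla d\varphi)(X,Y)=\nabla^{\varphi}_X d\varphi(Y)-d\varphi(\nabla^{M_1}_XY)$; the map $\varphi$ is harmonic if $\tau(\varphi)=0$ on $M_1$. Then the tension field of the identity map $\tilde I_d:(M,\tilde g)\to(M,g)$, $x\mapsto x$, is $$\tau(\tilde I_d)=\left[\frac{\operatorname{Hess}_f(\operatorname{grad} f,\operatorname{grad} f)}{(1-\|\operatorname{grad} f\|^2)^2}+\frac{\Delta f}{1-\|\operatorname{grad} f\|^2}\right]\operatorname{grad} f,$$ and $\tilde I_d$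 is harmonic if and only if, everywhere on $M$, $$\operatorname{Hess}_f(\operatorname{grad} f,\operatorname{grad} f)+(1-\|\operatorname{grad} f\|^2)\,\Delta f=0.$$ -/

import Mathlib

open Bundle Manifold
open scoped ContDiff Topology

noncomputable section

namespace RiemHarmonic

section Metric

variable {E : Type*} [NormedAddCommGroup E] [NormedSpace ℝ E]
  {H : Type*} [TopologicalSpace H] {I : ModelWithCorners ℝ E H}
  {M : Type*} [TopologicalSpace M] [ChartedSpace H M] [IsManifold I ∞ M]

/-- A smooth Riemannian metric on the manifold `M`. -/
abbrev Metric (I : ModelWithCorners ℝ E H) (M : Type*) [TopologicalSpace M] [ChartedSpace H M]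
    [IsManifold I ∞ M] : Type _ :=
  ContMDiffRiemannianMetric I ∞ E (fun x : M ↦ TangentSpace I x)

/-- The coordinate vector field with constant coefficients, in the preferred chart at `x`,
whose value at `x` is `v`. Two such fields at the same `x` commute near `x`. -/
def coordField {x : M} (v : TangentSpace I x) (p : M) : TangentSpace I p :=
  (trivializationAt E (fun y : M ↦ TangentSpace I y) x).symm p
    ((trivializationAt E (fun y : M ↦ TangentSpace I y) x) ⟨x, v⟩).2

/-- A basis of the tangent space `T_x M`. -/
def tangentBasis [FiniteDimensional ℝ E] (I : ModelWithCorners ℝ E H) (x : M) :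
    Module.Basis (Fin (Module.finrank ℝ E)) ℝ (TangentSpace I x) :=
  (Module.finBasis ℝ E : Module.Basis (Fin (Module.finrank ℝ E)) ℝ E)

/-- The inverse Gram matrix `g^{ij}` of the metric at `x`. -/
def gramInv [FiniteDimensional ℝ E] (g : Metric I M) (x : M) :
    Matrix (Fin (Module.finrank ℝ E)) (Fin (Module.finrank ℝ E)) ℝ :=
  (Matrix.of fun i j ↦ g.inner x (tangentBasis I x i) (tangentBasis I x j))⁻¹

/-- The vector `ℓ^♯ = ∑ g^{ij} ℓ(b_i) b_j` dual to a linear form `ℓ` on `T_x M`, i.e. the one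
with `g(ℓ^♯, w) = ℓ w`. -/
def sharp [FiniteDimensional ℝ E] (g : Metric I M) (x : M) (l : TangentSpace I x → ℝ) :
    TangentSpace I x :=
  ∑ i, ∑ j, (gramInv g x i j * l (tangentBasis I x i)) • tangentBasis I x j

/-- The trace `∑ g^{ij} B(b_i, b_j)` of a bilinear map on `T_x M` with respect to `g`. -/
def traceMetric [FiniteDimensional ℝ E] {W : Type*} [AddCommGroup W] [Module ℝ W]
    (g : Metric I M) (x : M) (B : TangentSpace I x → TangentSpace I x → W) : W :=
  ∑ i, ∑ j, gramInv g x i j • B (tangentBasis I x i) (tangentBasis I x j)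

/-- Christoffel symbols of the first kind at `x` in the preferred chart at `x`:
`½ (∂_u g(v, w) + ∂_v g(u, w) - ∂_w g(u, v))`. -/
def christoffelLower (g : Metric I M) {x : M} (u v w : TangentSpace I x) : ℝ :=
  (1 / 2 : ℝ) *
    (mvfderiv I (fun p ↦ g.inner p (coordField v p) (coordField w p)) x u
      + mvfderiv I (fun p ↦ g.inner p (coordField u p) (coordField w p)) x v
      - mvfderiv I (fun p ↦ g.inner p (coordField u p) (coordField v p)) x w)

/-- Christoffel symbols (of the second kind) `Γ(u, v)` at `x` in the preferred chart at `x`. -/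
def christoffel [FiniteDimensional ℝ E] (g : Metric I M) {x : M} (u v : TangentSpace I x) :
    TangentSpace I x :=
  sharp g x (fun w ↦ christoffelLower g u v w)

/-- The gradient of `f` with respect to `g`. -/
def grad [FiniteDimensional ℝ E] (g : Metric I M) (f : M → ℝ) (x : M) : TangentSpace I x :=
  sharp g x (fun w ↦ mvfderiv I f x w)

/-- `‖grad f‖² = g(grad f, grad f)`. -/
def gradNormSq [FiniteDimensional ℝ E] (g : Metric I M) (f : M → ℝ) (x : M) : ℝ :=
  g.inner x (grad g f x) (grad g f x)

end Metric

section Connection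

variable {E : Type*} [NormedAddCommGroup E] [NormedSpace ℝ E]
  {H : Type*} [TopologicalSpace H] {I : ModelWithCorners ℝ E H}
  {M : Type*} [TopologicalSpace M] [ChartedSpace H M] [IsManifold I ∞ M]
  {E' : Type*} [NormedAddCommGroup E'] [NormedSpace ℝ E'] [FiniteDimensional ℝ E']
  {H' : Type*} [TopologicalSpace H'] {I' : ModelWithCorners ℝ E' H'}
  {N : Type*} [TopologicalSpace N] [ChartedSpace H' N] [IsManifold I' ∞ N]

/-- The pull-back connection `∇^φ` on `φ⁻¹TN` of the Levi-Civita connection of `(N, h)`: the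
derivative `∇^φ_v W` at `x` of a section `W` of `φ⁻¹TN` is, in the preferred chart of `N` at `φ x`,
`dW(v) + Γ(dφ(v), W)`. -/
def pullbackCov (I : ModelWithCorners ℝ E H) (h : Metric I' N) (φ : M → N)
    (W : ∀ p : M, TangentSpace I' (φ p)) (x : M) (v : TangentSpace I x) :
    TangentSpace I' (φ x) :=
  (trivializationAt E' (fun y : N ↦ TangentSpace I' y) (φ x)).symm (φ x)
      (mvfderiv I (fun p ↦
        ((trivializationAt E' (fun y : N ↦ TangentSpace I' y) (φ x)) ⟨φ p, W p⟩).2) x v)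
    + christoffel h (mfderiv I I' φ x v) (W x)

/-- The Levi-Civita connection `∇_v Y` of `(N, h)`. -/
def leviCivita (h : Metric I' N) (Y : ∀ p : N, TangentSpace I' p) (x : N)
    (v : TangentSpace I' x) : TangentSpace I' x :=
  (trivializationAt E' (fun y : N ↦ TangentSpace I' y) x).symm x
      (mvfderiv I' (fun p ↦
        ((trivializationAt E' (fun y : N ↦ TangentSpace I' y) x) ⟨p, Y p⟩).2) x v)
    + christoffel h v (Y x)

end Connection

section Operators

variable {E : Type*} [NormedAddCommGroup E] [NormedSpace ℝ E] [FiniteDimensional ℝ E]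
  {H : Type*} [TopologicalSpace H] {I : ModelWithCorners ℝ E H}
  {M : Type*} [TopologicalSpace M] [ChartedSpace H M] [IsManifold I ∞ M]
  {E' : Type*} [NormedAddCommGroup E'] [NormedSpace ℝ E'] [FiniteDimensional ℝ E']
  {H' : Type*} [TopologicalSpace H'] {I' : ModelWithCorners ℝ E' H'}
  {N : Type*} [TopologicalSpace N] [ChartedSpace H' N] [IsManifold I' ∞ N]

/-- The Hessian `Hess_f(u, v) = u(V f) - (∇_u V) f` with respect to `g`, for the extension
`V = coordField v` of `v` (the value does not depend on the extension). -/
def hess (g : Metric I M) (f : M → ℝ) (x : M) (u v : TangentSpace I x) : ℝ :=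
  mvfderiv I (fun p ↦ mvfderiv I f p (coordField v p)) x u
    - mvfderiv I f x (leviCivita g (coordField v) x u)

/-- The Laplacian `Δ f = trace_g Hess_f`. -/
def laplacian (g : Metric I M) (f : M → ℝ) (x : M) : ℝ :=
  traceMetric g x (hess g f x)

/-- The second fundamental form `(∇dφ)(u, v) = ∇^φ_u (dφ(V)) - dφ(∇_u V)` of a map
`φ : (M, g) → (N, h)`, for the extension `V = coordField v` of `v` (the value does not depend on
the extension). -/
def secondFundamentalForm (g : Metric I M) (h : Metric I' N) (φ : M → N) (x : M)
    (u v : TangentSpace I x) : TangentSpace I' (φ x) :=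
  pullbackCov I h φ (fun p ↦ mfderiv I I' φ p (coordField v p)) x u
    - mfderiv I I' φ x (leviCivita g (coordField v) x u)

/-- The tension field `τ(φ) = trace_g ∇dφ` of a map `φ : (M, g) → (N, h)`. -/
def tensionField (g : Metric I M) (h : Metric I' N) (φ : M → N) (x : M) :
    TangentSpace I' (φ x) :=
  traceMetric g x (secondFundamentalForm g h φ x)

/-- A smooth map `φ : (M, g) → (N, h)` is harmonic if its tension field vanishes, i.e. if it
solves the Euler-Lagrange equation of the energy functional. -/
def IsHarmonicMap (g : Metric I M) (h : Metric I' N) (φ : M → N) : Prop :=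
  ContMDiff I I' ∞ φ ∧ ∀ x, tensionField g h φ x = 0

end Operators

section Deformation

variable {E : Type*} [NormedAddCommGroup E] [NormedSpace ℝ E] [FiniteDimensional ℝ E]
  {H : Type*} [TopologicalSpace H] {I : ModelWithCorners ℝ E H}
  {M : Type*} [TopologicalSpace M] [ChartedSpace H M] [IsManifold I ∞ M]

theorem isUnit_gram_det (g : Metric I M) (x : M) :
    IsUnit (Matrix.of fun i j ↦ g.inner x (tangentBasis I x i) (tangentBasis I x j)).det := by
  rw [isUnit_iff_ne_zero]
  intro h0
  obtain ⟨c, hc, hA⟩ := Matrix.exists_mulVec_eq_zero_iff.2 h0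
  set v : TangentSpace I x := ∑ j, c j • tangentBasis I x j with hv
  have h1 : ∀ i, g.inner x (tangentBasis I x i) v = 0 := by
    intro i
    have := congrFun hA i
    simp only [Matrix.mulVec, dotProduct, Matrix.of_apply, Pi.zero_apply] at this
    rw [hv, map_sum, ← this]
    exact Finset.sum_congr rfl fun j _ ↦ by rw [map_smul, smul_eq_mul, mul_comm]
  have h2 : g.inner x v v = 0 := by
    rw [g.symm]
    conv_lhs => rw [hv]
    rw [map_sum]
    refine Finset.sum_eq_zero fun j _ ↦ ?_
    rw [map_smul, g.symm, h1, smul_zero]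
  have h3 : v = 0 := by
    by_contra hne
    exact (g.pos x v hne).ne' h2
  apply hc
  funext j
  exact Fintype.linearIndependent_iff.1 (tangentBasis I x).linearIndependent c h3 j

/-- The defining property of `sharp`. -/
theorem inner_sharp (g : Metric I M) (x : M) (l : TangentSpace I x →L[ℝ] ℝ)
    (w : TangentSpace I x) : g.inner x (sharp g x l) w = l w := by
  set A : Matrix (Fin (Module.finrank ℝ E)) (Fin (Module.finrank ℝ E)) ℝ :=
    Matrix.of fun i j ↦ g.inner x (tangentBasis I x i) (tangentBasis I x j) with hA
  have key : (g.inner x (sharp g x l) : TangentSpace I x →ₗ[ℝ] ℝ) = l := by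
    refine (tangentBasis I x).ext fun k ↦ ?_
    have hinv : A⁻¹ * A = 1 := Matrix.nonsing_inv_mul _ (isUnit_gram_det g x)
    have e : g.inner x (sharp g x l) (tangentBasis I x k)
        = ∑ i, l (tangentBasis I x i) * (A⁻¹ * A) i k := by
      rw [g.symm, sharp, map_sum]
      refine Finset.sum_congr rfl fun i _ ↦ ?_
      rw [map_sum, Matrix.mul_apply, Finset.mul_sum]
      refine Finset.sum_congr rfl fun j _ ↦ ?_
      rw [map_smul, smul_eq_mul, g.symm]
      simp only [gramInv, hA, Matrix.of_apply]
      ring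
    change g.inner x (sharp g x l) (tangentBasis I x k) = l (tangentBasis I x k)
    rw [e, hinv]
    simp [Matrix.one_apply]
  exact congrArg (fun L : TangentSpace I x →ₗ[ℝ] ℝ ↦ L w) key

theorem inner_grad (g : Metric I M) (f : M → ℝ) (x : M) (w : TangentSpace I x) :
    g.inner x (grad g f x) w = mvfderiv I f x w :=
  inner_sharp g x (mvfderiv I f x) w

set_option linter.unusedSectionVars false in
theorem metric_self_nonneg (g : Metric I M) (x : M) (v : TangentSpace I x) :
    0 ≤ g.inner x v v := by
  rcases eq_or_ne v 0 with rfl | hv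
  · simp
  · exact (g.pos x v hv).le

theorem sq_mvfderiv_le (g : Metric I M) (f : M → ℝ) (x : M) (v : TangentSpace I x) :
    (mvfderiv I f x v) ^ 2 ≤ gradNormSq g f x * g.inner x v v := by
  have h1 : ∀ t : ℝ, 0 ≤ g.inner x v v - 2 * t * mvfderiv I f x v
      + t ^ 2 * gradNormSq g f x := by
    intro t
    have h := metric_self_nonneg g x (v - t • grad g f x)
    have e : g.inner x (v - t • grad g f x) (v - t • grad g f x)
        = g.inner x v v - 2 * t * mvfderiv I f x v + t ^ 2 * gradNormSq g f x := by
      rw [← inner_grad g f x v, gradNormSq]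
      simp only [map_sub, map_smul, sub_apply,
        smul_apply, smul_eq_mul]
      rw [g.symm x v (grad g f x)]
      ring
    rwa [e] at h
  rcases eq_or_ne (grad g f x) 0 with h0 | h0
  · rw [← inner_grad g f x v, gradNormSq, h0]
    simp
  · have hG : 0 < gradNormSq g f x := g.pos x _ h0
    have h := h1 (mvfderiv I f x v / gradNormSq g f x)
    have e : g.inner x v v - 2 * (mvfderiv I f x v / gradNormSq g f x) * mvfderiv I f x v
        + (mvfderiv I f x v / gradNormSq g f x) ^ 2 * gradNormSq g f x
        = g.inner x v v - (mvfderiv I f x v) ^ 2 / gradNormSq g f x := by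
      field_simp
      ring
    rw [e, sub_nonneg, div_le_iff₀ hG] at h
    linarith

/-- The symmetric tensor `g - df ⊗ df` at `x`. -/
def deformedInner (g : Metric I M) (f : M → ℝ) (x : M) :
    TangentSpace I x →L[ℝ] TangentSpace I x →L[ℝ] ℝ :=
  g.inner x - (mvfderiv I f x).smulRight (mvfderiv I f x)

set_option linter.unusedSectionVars false in
theorem deformedInner_apply (g : Metric I M) (f : M → ℝ) (x : M) (v w : TangentSpace I x) :
    deformedInner g f x v w = g.inner x v w - mvfderiv I f x v * mvfderiv I f x w := by
  simp [deformedInner]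

theorem le_deformedInner (g : Metric I M) (f : M → ℝ) (x : M) (v : TangentSpace I x) :
    (1 - gradNormSq g f x) * g.inner x v v ≤ deformedInner g f x v v := by
  rw [deformedInner_apply]
  have := sq_mvfderiv_le g f x v
  nlinarith

set_option synthInstance.maxHeartbeats 200000 in
set_option maxHeartbeats 800000 in
theorem contMDiff_deformedInner (g : Metric I M) {f : M → ℝ} (hf : ContMDiff I 𝓘(ℝ, ℝ) ∞ f) :
    ContMDiff I (I.prod 𝓘(ℝ, E →L[ℝ] E →L[ℝ] ℝ)) ∞
      (fun b ↦ TotalSpace.mk' (E →L[ℝ] E →L[ℝ] ℝ)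
        (E := fun x : M ↦ TangentSpace I x →L[ℝ] TangentSpace I x →L[ℝ] ℝ) b
        (deformedInner g f b)) := by
  have h2 : ContMDiff I (I.prod 𝓘(ℝ, E →L[ℝ] E →L[ℝ] ℝ)) ∞
      (fun b ↦ TotalSpace.mk' (E →L[ℝ] E →L[ℝ] ℝ)
        (E := fun x : M ↦ TangentSpace I x →L[ℝ] TangentSpace I x →L[ℝ] ℝ) b
        ((mvfderiv I f b).smulRight (mvfderiv I f b))) := by
    intro x
    have hd := (hf x).mfderiv_const (m := ∞) (by norm_num)
    rw [contMDiffAt_hom_bundle]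
    refine ⟨contMDiffAt_id, ?_⟩
    have hsm : ContMDiffAt I 𝓘(ℝ, E →L[ℝ] E →L[ℝ] ℝ) ∞ (fun b ↦
        ContinuousLinearMap.smulRightL ℝ E (E →L[ℝ] ℝ)
          (inTangentCoordinates I 𝓘(ℝ, ℝ) id f (mfderiv I 𝓘(ℝ, ℝ) f) x b)
          (inTangentCoordinates I 𝓘(ℝ, ℝ) id f (mfderiv I 𝓘(ℝ, ℝ) f) x b)) x :=
      (contMDiffAt_const.clm_apply hd).clm_apply hd
    refine hsm.congr_of_eventuallyEq ?_
    filter_upwards [(trivializationAt E (fun y : M ↦ TangentSpace I y) x).open_baseSet.mem_nhds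
      (FiberBundle.mem_baseSet_trivializationAt' x)] with b hb
    ext v w
    have hb' : b ∈ (trivializationAt (E →L[ℝ] ℝ)
        (fun y : M ↦ TangentSpace I y →L[ℝ] ℝ) x).baseSet := by
      rw [hom_trivializationAt_baseSet]
      exact ⟨hb, trivial⟩
    have e : (trivializationAt (E →L[ℝ] ℝ)
        (fun y : M ↦ TangentSpace I y →L[ℝ] ℝ) x).linearMapAt ℝ b (mvfderiv I f b)
        = (mvfderiv I f b).comp
          ((trivializationAt E (fun y : M ↦ TangentSpace I y) x).symmL ℝ b) := by
      rw [Trivialization.coe_linearMapAt_of_mem _ hb']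
      change ((trivializationAt (E →L[ℝ] ℝ)
        (fun y : M ↦ TangentSpace I y →L[ℝ] ℝ) x) ⟨b, mvfderiv I f b⟩).2 = _
      rw [hom_trivializationAt_apply]
      ext u
      simp [ContinuousLinearMap.inCoordinates]
    simp only [inTangentCoordinates, ContinuousLinearMap.inCoordinates,
      ContinuousLinearMap.comp_apply, ContinuousLinearMap.smulRight_apply,
      ContinuousLinearMap.smulRightL_apply_apply, map_smul, smul_apply,
      Trivialization.continuousLinearMapAt_apply]
    rw [e]
    have e2 : ∀ c : ℝ, (trivializationAt ℝ (fun y : ℝ ↦ TangentSpace 𝓘(ℝ, ℝ) y)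
        (f x)).linearMapAt ℝ (f b) c = c := fun c ↦
      congrArg (fun L : ℝ →L[ℝ] ℝ ↦ L c)
        (TangentBundle.continuousLinearMapAt_model_space (𝕜 := ℝ) (f x) (f b))
    exact (congrArg₂ (· * ·) (e2 _) (e2 _)).symm
  exact g.contMDiff.sub_section h2

/-- The Riemannian metric `g̃ = g - df ⊗ df`, for a smooth function `f` with `‖grad f‖ < 1`. -/
def deformedMetric (g : Metric I M) (f : M → ℝ) (hf : ContMDiff I 𝓘(ℝ, ℝ) ∞ f)
    (hgrad : ∀ x, gradNormSq g f x < 1) : Metric I M where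
  inner := deformedInner g f
  symm x v w := by
    rw [deformedInner_apply, deformedInner_apply, g.symm, mul_comm]
  pos x v hv :=
    lt_of_lt_of_le (mul_pos (sub_pos.2 (hgrad x)) (g.pos x v hv)) (le_deformedInner g f x v)
  isVonNBounded x := by
    have hc : 0 < 1 - gradNormSq g f x := sub_pos.2 (hgrad x)
    set s : ℝ := Real.sqrt (1 - gradNormSq g f x) with hs
    have hs0 : 0 < s := Real.sqrt_pos.2 hc
    have hss : s * s = 1 - gradNormSq g f x := Real.mul_self_sqrt hc.le
    refine ((g.isVonNBounded x).image
      (s⁻¹ • ContinuousLinearMap.id ℝ (TangentSpace I x))).subset ?_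
    intro v hv
    refine ⟨s • v, ?_, ?_⟩
    · change g.inner x (s • v) (s • v) < 1
      have h1 : g.inner x (s • v) (s • v) = (1 - gradNormSq g f x) * g.inner x v v := by
        simp only [map_smul, smul_apply, smul_eq_mul]
        rw [← hss]
        ring
      rw [h1]
      exact lt_of_le_of_lt (le_deformedInner g f x v) hv
    · simp [smul_smul, hs0.ne']
  contMDiff := contMDiff_deformedInner g hf

end Deformation

end RiemHarmonic

end

/-! Write G = 1 - ‖grad f‖². In a chart, the first-kind Christoffel symbols of g̃ are those of g
minus ∂²f(u,v) df(w): of the six terms produced by differentiating df ⊗ df, four cancel. Raising the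
index gives Γ̃(u,v) = Γ(u,v) - (Hess_f(u,v)/G) grad f (`christoffel_deformedMetric`). The second
fundamental form of the identity is Γ - Γ̃, hence τ = (tr_g̃ Hess_f / G) grad f. The inverse of the
rank-one perturbation g - df ⊗ df is g⁻¹ + (grad f ⊗ grad f)/G, so tr_g̃ Hess_f = Δf + Hess_f(grad
f, grad f)/G (`traceMetric_deformedMetric_hess`), and the formula follows.

The harmonicity equation says exactly tr_g̃ Hess_f = 0, and it clearly implies τ = 0. Conversely, τ
= 0 gives the equation only where grad f ≠ 0. Suppose the trace is nonzero at a point x. By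
continuity it is nonzero near x, so grad f vanishes near x, so Hess_f = 0 at x, a contradiction
(`traceMetric_hess_eq_zero_of_isHarmonicMap`).

The continuity needs work because every object at p is defined in the preferred chart at p, which
may jump with p. Near x the trace therefore has to be rewritten in the single chart at x, by
coordinate invariance of the Hessian (`localHess_comp`) and of the trace (`metricTrace_compl₁₂`). -/

noncomputable section

namespace RiemHarmonic

/-! ### Christoffel symbols and Hessians on open sets of a vector space. -/

section LocalCalculus

set_option synthInstance.maxHeartbeats 200000
set_option maxHeartbeats 800000

variable {E : Type*} [NormedAddCommGroup E] [NormedSpace ℝ E]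

/-- Christoffel symbols of the first kind of a metric `G` given on an open set of `E`. -/
def christoffelForm (G : E → E →L[ℝ] E →L[ℝ] ℝ) (y u v w : E) : ℝ :=
  (1 / 2 : ℝ) * (fderiv ℝ G y u v w + fderiv ℝ G y v u w - fderiv ℝ G y w u v)

theorem fderiv_apply_apply {G : E → E →L[ℝ] E →L[ℝ] ℝ} {y : E} (hG : DifferentiableAt ℝ G y)
    (u v w : E) : fderiv ℝ (fun z ↦ G z v w) y u = fderiv ℝ G y u v w := by
  have h := (hG.hasFDerivAt.clm_apply (hasFDerivAt_const v y)).clm_apply (hasFDerivAt_const w y)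
  rw [h.fderiv]
  simp

/-- The Hessian of `F` with respect to the metric `G` on an open set of `E`, in terms of the
gradient `s` of `F`. -/
def localHess (G : E → E →L[ℝ] E →L[ℝ] ℝ) (F : E → ℝ) (y s : E) : E →ₗ[ℝ] E →ₗ[ℝ] ℝ :=
  LinearMap.mk₂ ℝ (fun u v ↦ fderiv ℝ (fderiv ℝ F) y u v - christoffelForm G y u v s)
    (fun u u' v ↦ by simp [christoffelForm]; ring)
    (fun c u v ↦ by simp [christoffelForm]; ring)
    (fun u v v' ↦ by simp [christoffelForm]; ring)
    (fun c u v ↦ by simp [christoffelForm]; ring)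

theorem localHess_apply (G : E → E →L[ℝ] E →L[ℝ] ℝ) (F : E → ℝ) (y s u v : E) :
    localHess G F y s u v = fderiv ℝ (fderiv ℝ F) y u v - christoffelForm G y u v s := rfl

/-- By symmetry of second derivatives, F_uv F_w occurs twice with sign plus, while F_uw F_v and F_vw
F_u each occur once with either sign. The factor ½ leaves one F_uv F_w. -/
theorem christoffelForm_sub_fderiv_mul_fderiv {G G' : E → E →L[ℝ] E →L[ℝ] ℝ} {F : E → ℝ} {y : E}
    (hG : DifferentiableAt ℝ G y) (hG' : DifferentiableAt ℝ G' y) (hF : ContDiffAt ℝ 2 F y)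
    (h : ∀ᶠ z in 𝓝 y, ∀ a b, G' z a b = G z a b - fderiv ℝ F z a * fderiv ℝ F z b) (u v w : E) :
    christoffelForm G' y u v w
      = christoffelForm G y u v w - fderiv ℝ (fderiv ℝ F) y u v * fderiv ℝ F y w := by
  have hdF : DifferentiableAt ℝ (fderiv ℝ F) y :=
    (hF.fderiv_right (m := 1) (by norm_num)).differentiableAt one_ne_zero
  have hsymm : ∀ a b, fderiv ℝ (fderiv ℝ F) y a b = fderiv ℝ (fderiv ℝ F) y b a :=
    fun a b ↦ (hF.isSymmSndFDerivAt (by simp)).eq a b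
  have hD : ∀ a b c, fderiv ℝ G' y a b c = fderiv ℝ G y a b c
      - (fderiv ℝ F y b * fderiv ℝ (fderiv ℝ F) y a c
        + fderiv ℝ (fderiv ℝ F) y a b * fderiv ℝ F y c) := by
    intro a b c
    have hd : ∀ b, HasFDerivAt (fun z ↦ fderiv ℝ F z b) _ y := fun b ↦
      hdF.hasFDerivAt.clm_apply (hasFDerivAt_const b y)
    have hGd := (hG.hasFDerivAt.clm_apply (hasFDerivAt_const b y)).clm_apply (hasFDerivAt_const c y)
    have e : (fun z ↦ G' z b c) =ᶠ[𝓝 y] fun z ↦ G z b c - fderiv ℝ F z b * fderiv ℝ F z c := by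
      filter_upwards [h] with z hz using hz b c
    rw [← fderiv_apply_apply hG', e.fderiv_eq, (hGd.fun_sub ((hd b).fun_mul (hd c))).fderiv]
    simp
    ring
  simp only [christoffelForm, hD]
  rw [hsymm v u, hsymm w u, hsymm w v]
  ring

theorem fderiv_fderiv_comp {F : E → ℝ} {ψ : E → E} {y : E} (hF : ContDiffAt ℝ 2 F (ψ y))
    (hψ : ContDiffAt ℝ 2 ψ y) (u v : E) :
    fderiv ℝ (fderiv ℝ (fun z ↦ F (ψ z))) y u v
      = fderiv ℝ (fderiv ℝ F) (ψ y) (fderiv ℝ ψ y u) (fderiv ℝ ψ y v)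
        + fderiv ℝ F (ψ y) (fderiv ℝ (fderiv ℝ ψ) y u v) := by
  have hdF : DifferentiableAt ℝ (fderiv ℝ F) (ψ y) :=
    (hF.fderiv_right (m := 1) (by norm_num)).differentiableAt one_ne_zero
  have hdψ : DifferentiableAt ℝ (fderiv ℝ ψ) y :=
    (hψ.fderiv_right (m := 1) (by norm_num)).differentiableAt one_ne_zero
  have hψ1 : DifferentiableAt ℝ ψ y := hψ.differentiableAt two_ne_zero
  have e : fderiv ℝ (fun z ↦ F (ψ z)) =ᶠ[𝓝 y] fun z ↦ (fderiv ℝ F (ψ z)).comp (fderiv ℝ ψ z) := by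
    filter_upwards [hψ.eventually (by simp),
      hψ.continuousAt.eventually (hF.eventually (by simp))] with z h1 h2
    exact fderiv_comp z (h2.differentiableAt two_ne_zero) (h1.differentiableAt two_ne_zero)
  have hc : HasFDerivAt (fun z ↦ fderiv ℝ F (ψ z)) _ y := hdF.hasFDerivAt.comp y hψ1.hasFDerivAt
  rw [e.fderiv_eq, (hc.clm_comp hdψ.hasFDerivAt).fderiv]
  simp [add_comm]

/-- The inhomogeneous transformation law: differentiating the two factors ψ' produces terms in ψ'',
all but one of which cancel by symmetry of ψ'' and of the metric. -/
theorem christoffelForm_comp {G G' : E → E →L[ℝ] E →L[ℝ] ℝ} {ψ : E → E} {y : E}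
    (hG : DifferentiableAt ℝ G (ψ y)) (hG' : DifferentiableAt ℝ G' y) (hψ : ContDiffAt ℝ 2 ψ y)
    (h : ∀ᶠ z in 𝓝 y, ∀ a b, G' z a b = G (ψ z) (fderiv ℝ ψ z a) (fderiv ℝ ψ z b))
    (hGsymm : ∀ a b, G (ψ y) a b = G (ψ y) b a) (u v w : E) :
    christoffelForm G' y u v w
      = christoffelForm G (ψ y) (fderiv ℝ ψ y u) (fderiv ℝ ψ y v) (fderiv ℝ ψ y w)
        + G (ψ y) (fderiv ℝ ψ y w) (fderiv ℝ (fderiv ℝ ψ) y u v) := by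
  have hdψ : DifferentiableAt ℝ (fderiv ℝ ψ) y :=
    (hψ.fderiv_right (m := 1) (by norm_num)).differentiableAt one_ne_zero
  have hψ1 : DifferentiableAt ℝ ψ y := hψ.differentiableAt two_ne_zero
  have hsymm : ∀ a b, fderiv ℝ (fderiv ℝ ψ) y a b = fderiv ℝ (fderiv ℝ ψ) y b a :=
    fun a b ↦ (hψ.isSymmSndFDerivAt (by simp)).eq a b
  have hD : ∀ a b c, fderiv ℝ G' y a b c
      = fderiv ℝ G (ψ y) (fderiv ℝ ψ y a) (fderiv ℝ ψ y b) (fderiv ℝ ψ y c)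
        + G (ψ y) (fderiv ℝ (fderiv ℝ ψ) y a b) (fderiv ℝ ψ y c)
        + G (ψ y) (fderiv ℝ ψ y b) (fderiv ℝ (fderiv ℝ ψ) y a c) := by
    intro a b c
    have e : (fun z ↦ G' z b c) =ᶠ[𝓝 y] fun z ↦ G (ψ z) (fderiv ℝ ψ z b) (fderiv ℝ ψ z c) := by
      filter_upwards [h] with z hz using hz b c
    have hd : ∀ b, HasFDerivAt (fun z ↦ fderiv ℝ ψ z b) _ y := fun b ↦
      hdψ.hasFDerivAt.clm_apply (hasFDerivAt_const b y)
    have hGc : HasFDerivAt (fun z ↦ G (ψ z)) _ y :=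
      HasFDerivAt.comp (g := G) y hG.hasFDerivAt hψ1.hasFDerivAt
    rw [← fderiv_apply_apply hG', e.fderiv_eq, ((hGc.clm_apply (hd b)).clm_apply (hd c)).fderiv]
    simp
    ring
  simp only [christoffelForm, hD]
  rw [hsymm v u, hsymm w u, hsymm w v, hGsymm _ (fderiv ℝ ψ y w),
    hGsymm (fderiv ℝ (fderiv ℝ ψ) y u w) (fderiv ℝ ψ y v)]
  ring

/-- The Hessian is invariant under changes of coordinates. -/
theorem localHess_comp {G G' : E → E →L[ℝ] E →L[ℝ] ℝ} {F F' : E → ℝ} {ψ : E → E} {y s : E}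
    (hG : DifferentiableAt ℝ G (ψ y)) (hG' : DifferentiableAt ℝ G' y)
    (hF : ContDiffAt ℝ 2 F (ψ y)) (hψ : ContDiffAt ℝ 2 ψ y)
    (h : ∀ᶠ z in 𝓝 y, ∀ a b, G' z a b = G (ψ z) (fderiv ℝ ψ z a) (fderiv ℝ ψ z b))
    (hF' : F' =ᶠ[𝓝 y] fun z ↦ F (ψ z))
    (hGsymm : ∀ a b, G (ψ y) a b = G (ψ y) b a)
    (hs : ∀ a, G (ψ y) (fderiv ℝ ψ y s) a = fderiv ℝ F (ψ y) a) :
    localHess G' F' y s = (localHess G F (ψ y) (fderiv ℝ ψ y s)).compl₁₂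
      (fderiv ℝ ψ y : E →ₗ[ℝ] E) (fderiv ℝ ψ y : E →ₗ[ℝ] E) := by
  ext u v
  rw [LinearMap.compl₁₂_apply]
  simp only [localHess_apply, ContinuousLinearMap.coe_coe]
  -- The second-order chain rule contributes dF(ψ''(u,v)). Since ψ'(s) is the gradient of F, `hs`
  -- turns the inhomogeneous Christoffel term into the same quantity, and the two cancel.
  rw [hF'.fderiv.fderiv_eq, fderiv_fderiv_comp hF hψ,
    christoffelForm_comp hG hG' hψ h hGsymm, hs]
  ring

end LocalCalculus

/-! ### Trace of a bilinear form with respect to another, and its invariance. -/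

section MetricTrace

variable {E : Type*} [AddCommGroup E] [Module ℝ E] {ι : Type*} [Fintype ι] [DecidableEq ι]

/-- The trace of the bilinear form `B` with respect to the bilinear form `G`, in the basis `b`. -/
def metricTrace (b : Module.Basis ι ℝ E) (G B : E →ₗ[ℝ] E →ₗ[ℝ] ℝ) : ℝ :=
  ((LinearMap.toMatrix₂ b b G)⁻¹ * (LinearMap.toMatrix₂ b b B).transpose).trace

theorem metricTrace_eq_sum (b : Module.Basis ι ℝ E) (G B : E →ₗ[ℝ] E →ₗ[ℝ] ℝ) :
    metricTrace b G B = ∑ i, ∑ j, (Matrix.of fun i j ↦ G (b i) (b j))⁻¹ i j * B (b i) (b j) := by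
  have e : LinearMap.toMatrix₂ b b G = Matrix.of fun i j ↦ G (b i) (b j) := by
    ext i j
    simp [LinearMap.toMatrix₂_apply]
  simp [metricTrace, e, Matrix.trace, Matrix.mul_apply, LinearMap.toMatrix₂_apply]

/-- Both Gram matrices change by a congruence X ↦ Pᵀ X P, so the product inside the trace is merely
conjugated by P. -/
theorem metricTrace_compl₁₂ (b : Module.Basis ι ℝ E) (G B : E →ₗ[ℝ] E →ₗ[ℝ] ℝ) {A : E →ₗ[ℝ] E}
    (hA : IsUnit A) :
    metricTrace b (G.compl₁₂ A A) (B.compl₁₂ A A) = metricTrace b G B := by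
  have hdet : IsUnit (LinearMap.toMatrix b b A).det := by
    rw [LinearMap.det_toMatrix]
    exact hA.map LinearMap.det
  have hdet' : IsUnit (LinearMap.toMatrix b b A).transpose.det := by
    rwa [Matrix.det_transpose]
  rw [metricTrace, metricTrace, LinearMap.toMatrix₂_compl₁₂ b b, LinearMap.toMatrix₂_compl₁₂ b b]
  set P := LinearMap.toMatrix b b A
  set C := LinearMap.toMatrix₂ b b G
  set D := LinearMap.toMatrix₂ b b B
  rw [Matrix.mul_inv_rev, Matrix.mul_inv_rev, Matrix.transpose_mul, Matrix.transpose_mul,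
    Matrix.transpose_transpose]
  have e : P⁻¹ * (C⁻¹ * P.transpose⁻¹) * (P.transpose * (D.transpose * P))
      = P⁻¹ * (C⁻¹ * D.transpose * P) := by
    rw [Matrix.mul_assoc, Matrix.mul_assoc, Matrix.nonsing_inv_mul_cancel_left _ _ hdet',
      Matrix.mul_assoc]
  rw [e, Matrix.trace_mul_comm, Matrix.mul_nonsing_inv_cancel_right _ _ hdet]

end MetricTrace

/-! ### Metrics, fields and differentials read in a chart. -/

section LocalRepresentation

set_option synthInstance.maxHeartbeats 200000
set_option maxHeartbeats 800000

variable {E : Type*} [NormedAddCommGroup E] [NormedSpace ℝ E]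
  {H : Type*} [TopologicalSpace H] {I : ModelWithCorners ℝ E H}
  {M : Type*} [TopologicalSpace M] [ChartedSpace H M] [IsManifold I ∞ M]

/-- The metric `g` in the preferred chart at `x`. -/
def localMetric (g : Metric I M) (x : M) (y : E) : E →L[ℝ] E →L[ℝ] ℝ :=
  ContinuousLinearMap.bilinearComp (E := E) (F := E)
    (g.inner ((extChartAt I x).symm y) : E →L[ℝ] E →L[ℝ] ℝ)
    (tangentCoordChange I x ((extChartAt I x).symm y) ((extChartAt I x).symm y))
    (tangentCoordChange I x ((extChartAt I x).symm y) ((extChartAt I x).symm y))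

theorem localMetric_apply (g : Metric I M) (x : M) (y u v : E) :
    localMetric g x y u v = (g.inner ((extChartAt I x).symm y) : E →L[ℝ] E →L[ℝ] ℝ)
      (tangentCoordChange I x ((extChartAt I x).symm y) ((extChartAt I x).symm y) u)
      (tangentCoordChange I x ((extChartAt I x).symm y) ((extChartAt I x).symm y) v) := rfl

theorem localMetric_symm (g : Metric I M) (x : M) (y u v : E) :
    localMetric g x y u v = localMetric g x y v u := g.symm _ _ _

theorem localMetric_extChartAt (g : Metric I M) {x p : M} (hp : p ∈ (extChartAt I x).source)
    (u v : E) : localMetric g x (extChartAt I x p) u v = (g.inner p : E →L[ℝ] E →L[ℝ] ℝ)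
      (tangentCoordChange I x p p u) (tangentCoordChange I x p p v) := by
  rw [localMetric_apply, (extChartAt I x).left_inv hp]

theorem localMetric_extChartAt_self (g : Metric I M) (x : M) (u v : E) :
    localMetric g x (extChartAt I x x) u v = (g.inner x : E →L[ℝ] E →L[ℝ] ℝ) u v := by
  rw [localMetric_extChartAt g (mem_extChartAt_source x),
    tangentCoordChange_self (mem_extChartAt_source x),
    tangentCoordChange_self (mem_extChartAt_source x)]

theorem tangentCoordChange_cancel {x p : M} (hp : p ∈ (extChartAt I x).source) (u : E) :
    tangentCoordChange I p x p (tangentCoordChange I x p p u) = u := by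
  rw [tangentCoordChange_comp ⟨⟨hp, mem_extChartAt_source p⟩, hp⟩, tangentCoordChange_self hp]

theorem tangentCoordChange_cancel' {x p : M} (hp : p ∈ (extChartAt I x).source) (u : E) :
    tangentCoordChange I x p p (tangentCoordChange I p x p u) = u := by
  rw [tangentCoordChange_comp ⟨⟨mem_extChartAt_source p, hp⟩, mem_extChartAt_source p⟩,
    tangentCoordChange_self (mem_extChartAt_source p)]

/-- The space T_pM is identified with E through the preferred chart at p, so a field that is
constant in the chart at x acquires the transition from x to p. -/
theorem coordField_eq {x p : M} (hp : p ∈ (extChartAt I x).source) (v : E) :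
    (coordField (I := I) (x := x) v p : E) = tangentCoordChange I x p p v := by
  have hp' : p ∈ (chartAt H x).source := by rwa [extChartAt_source] at hp
  have hb : p ∈ (trivializationAt E (fun y : M ↦ TangentSpace I y) x).baseSet := by
    rwa [TangentBundle.trivializationAt_baseSet]
  have h1 : ((trivializationAt E (fun y : M ↦ TangentSpace I y) x) ⟨x, v⟩).2 = v :=
    tangentCoordChange_self (I := I) (mem_extChartAt_source x)
  change (trivializationAt E (fun y : M ↦ TangentSpace I y) x).symm p
    ((trivializationAt E (fun y : M ↦ TangentSpace I y) x) ⟨x, v⟩).2 = _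
  rw [h1, ← Trivialization.symmL_apply (R := ℝ) _ hb]
  exact congrArg (fun L : E →L[ℝ] E ↦ L v) (TangentBundle.symmL_trivializationAt_eq_core hp')

theorem coordField_self (x : M) (v : E) : (coordField (I := I) (x := x) v x : E) = v := by
  rw [coordField_eq (mem_extChartAt_source x), tangentCoordChange_self (mem_extChartAt_source x)]

theorem mfderiv_extChartAt_eq {x p : M} (hp : p ∈ (extChartAt I x).source) (v : E) :
    (mfderiv I 𝓘(ℝ, E) (extChartAt I x) p : E →L[ℝ] E) v = tangentCoordChange I p x p v := by
  have hp' : p ∈ (chartAt H x).source := by rwa [extChartAt_source] at hp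
  exact congrArg (fun L : E →L[ℝ] E ↦ L v)
    ((TangentBundle.continuousLinearMapAt_trivializationAt hp').symm.trans
      (TangentBundle.continuousLinearMapAt_trivializationAt_eq_core hp'))

theorem mvfderiv_eq_fderiv {V : Type*} [NormedAddCommGroup V] [NormedSpace ℝ V] {x p : M}
    (hp : p ∈ (extChartAt I x).source) {h : M → V} {k : E → V}
    (hk : DifferentiableAt ℝ k (extChartAt I x p))
    (he : h =ᶠ[𝓝 p] fun q ↦ k (extChartAt I x q)) (v : E) :
    (mvfderiv I h p : E →L[ℝ] V) v
      = fderiv ℝ k (extChartAt I x p) (tangentCoordChange I p x p v) := by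
  have hp' : p ∈ (chartAt H x).source := by rwa [extChartAt_source] at hp
  have h1 : mfderiv I 𝓘(ℝ, V) h p = _ := he.mfderiv_eq.trans
    (mfderiv_comp (I' := 𝓘(ℝ, E)) p hk.mdifferentiableAt (mdifferentiableAt_extChartAt hp'))
  have h2 : (mvfderiv I h p : E →L[ℝ] V) v = (mfderiv I 𝓘(ℝ, V) h p : E →L[ℝ] V) v := rfl
  rw [h2, ← mfderiv_extChartAt_eq hp, ← mfderiv_eq_fderiv]
  exact congrArg (fun L : E →L[ℝ] V ↦ L v) h1

variable [BoundarylessManifold I M]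

-- Without boundary, derivatives within `range I` are ordinary derivatives near the base point,
-- which makes the Euclidean calculus applicable.
omit [IsManifold I ∞ M] in
theorem range_mem_nhds (x : M) : Set.range I ∈ 𝓝 (extChartAt I x x) :=
  range_mem_nhds_isInteriorPoint BoundarylessManifold.isInteriorPoint

omit [IsManifold I ∞ M] in
theorem extChartAt_target_mem_nhds_self (x : M) :
    (extChartAt I x).target ∈ 𝓝 (extChartAt I x x) := by
  have := extChartAt_target_mem_nhdsWithin (I := I) x
  rwa [nhdsWithin_eq_nhds.2 (range_mem_nhds x)] at this

/-- Near x, `localMetric` is the section g read in the trivialization at x, so it inherits the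
smoothness of that section. -/
theorem contDiffAt_localMetric (g : Metric I M) (x : M) :
    ContDiffAt ℝ ∞ (localMetric g x) (extChartAt I x x) := by
  have h := ((contMDiffAt_hom_bundle _).1 (g.contMDiff x)).2
  have h2 := ((contMDiffAt_iff.1 h).2).contDiffAt (range_mem_nhds x)
  refine h2.congr_of_eventuallyEq ?_
  filter_upwards [extChartAt_target_mem_nhds_self (I := I) x] with y hy
  have hp := (extChartAt I x).map_target hy
  set p := (extChartAt I x).symm y with hpy
  have hp' : p ∈ (chartAt H x).source := by rwa [extChartAt_source] at hp
  have hb : p ∈ (trivializationAt (E →L[ℝ] ℝ)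
      (fun y : M ↦ TangentSpace I y →L[ℝ] ℝ) x).baseSet := by
    rw [hom_trivializationAt_baseSet]
    exact ⟨by rwa [TangentBundle.trivializationAt_baseSet], trivial⟩
  have hS : ∀ u : E, ((trivializationAt E (fun y : M ↦ TangentSpace I y) x).symmL ℝ p u : E)
      = tangentCoordChange I x p p u := fun u ↦
    congrArg (fun L : E →L[ℝ] E ↦ L u) (TangentBundle.symmL_trivializationAt_eq_core hp')
  ext u v
  simp only [Function.comp_apply, ContinuousLinearMap.inCoordinates]
  have e : ∀ l : TangentSpace I p →L[ℝ] ℝ, (trivializationAt (E →L[ℝ] ℝ)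
      (fun y : M ↦ TangentSpace I y →L[ℝ] ℝ) x).linearMapAt ℝ p l
      = l.comp ((trivializationAt E (fun y : M ↦ TangentSpace I y) x).symmL ℝ p) := by
    intro l
    rw [Trivialization.coe_linearMapAt_of_mem _ hb]
    change ((trivializationAt (E →L[ℝ] ℝ)
      (fun y : M ↦ TangentSpace I y →L[ℝ] ℝ) x) ⟨p, l⟩).2 = _
    rw [hom_trivializationAt_apply]
    ext u
    simp [ContinuousLinearMap.inCoordinates]
  simp only [extChartAt_model_space_eq_id, PartialEquiv.refl_coe, id]
  refine Eq.trans ?_ (congrArg (fun L : E →L[ℝ] ℝ ↦ L v) (e _)).symm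
  change _ = (g.inner p ((trivializationAt E (fun y : M ↦ TangentSpace I y) x).symmL ℝ p u)
    ((trivializationAt E (fun y : M ↦ TangentSpace I y) x).symmL ℝ p v))
  rw [localMetric_apply, ← hpy, ← hS u, ← hS v]

omit [IsManifold I ∞ M] in
theorem contDiffAt_comp_extChartAt_symm {f : M → ℝ} (hf : ContMDiff I 𝓘(ℝ, ℝ) ∞ f) (x : M) :
    ContDiffAt ℝ ∞ (fun y ↦ f ((extChartAt I x).symm y)) (extChartAt I x x) := by
  have h := (contMDiffAt_iff.1 (hf x)).2
  simpa using! h.contDiffAt (range_mem_nhds x)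

end LocalRepresentation

/-! ### The connection, second fundamental form and Hessian in the preferred chart. -/

section Christoffel

set_option synthInstance.maxHeartbeats 200000
set_option maxHeartbeats 800000

variable {E : Type*} [NormedAddCommGroup E] [NormedSpace ℝ E]
  {H : Type*} [TopologicalSpace H] {I : ModelWithCorners ℝ E H}
  {M : Type*} [TopologicalSpace M] [ChartedSpace H M] [IsManifold I ∞ M]

omit [IsManifold I ∞ M] in
theorem eventually_mem_extChartAt_source (x : M) : ∀ᶠ q in 𝓝 x, q ∈ (extChartAt I x).source :=
  extChartAt_source_mem_nhds x

theorem differentiableAt_localMetric [BoundarylessManifold I M] (g : Metric I M) (x : M) :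
    DifferentiableAt ℝ (localMetric g x) (extChartAt I x x) :=
  (contDiffAt_localMetric g x).differentiableAt (by simp)

theorem christoffelLower_eq [BoundarylessManifold I M] (g : Metric I M) (p : M) (u v w : E) :
    christoffelLower (I := I) (x := p) g u v w
      = christoffelForm (localMetric g p) (extChartAt I p p) u v w := by
  have hG := differentiableAt_localMetric g p
  have key : ∀ a b c : E,
      (mvfderiv I (fun q ↦ g.inner q (coordField (x := p) a q) (coordField (x := p) b q)) p
        : E →L[ℝ] ℝ) c = fderiv ℝ (localMetric g p) (extChartAt I p p) c a b := by
    intro a b c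
    rw [mvfderiv_eq_fderiv (k := fun y ↦ localMetric g p y a b) (mem_extChartAt_source p)
        ((hG.clm_apply (differentiableAt_const a)).clm_apply (differentiableAt_const b)) ?_,
      tangentCoordChange_self (mem_extChartAt_source p), fderiv_apply_apply hG]
    filter_upwards [eventually_mem_extChartAt_source (I := I) p] with q hq
    rw [localMetric_extChartAt g hq, ← coordField_eq hq, ← coordField_eq hq]
  rw [christoffelForm, ← key, ← key, ← key]
  rfl

/-- The field has constant components near p, so the derivative term of its covariant derivative
vanishes and only the Christoffel term survives. -/
theorem trivializationAt_symm_mvfderiv_coordField (p : M) (u v : E) :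
    (trivializationAt E (fun y : M ↦ TangentSpace I y) p).symm p
      (mvfderiv I (fun q ↦ ((trivializationAt E (fun y : M ↦ TangentSpace I y) p)
        ⟨q, coordField (x := p) v q⟩).2) p u) = 0 := by
  have e : (fun q ↦ ((trivializationAt E (fun y : M ↦ TangentSpace I y) p)
      ⟨q, coordField (x := p) v q⟩).2) =ᶠ[𝓝 p] fun _ ↦ v := by
    filter_upwards [eventually_mem_extChartAt_source (I := I) p] with q hq
    have hb : q ∈ (trivializationAt E (fun y : M ↦ TangentSpace I y) p).baseSet := by
      rwa [TangentBundle.trivializationAt_baseSet, ← extChartAt_source I]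
    have h1 : ((trivializationAt E (fun y : M ↦ TangentSpace I y) p) ⟨p, v⟩).2 = v :=
      tangentCoordChange_self (I := I) (mem_extChartAt_source p)
    change ((trivializationAt E (fun y : M ↦ TangentSpace I y) p) ⟨q,
      (trivializationAt E (fun y : M ↦ TangentSpace I y) p).symm q
        ((trivializationAt E (fun y : M ↦ TangentSpace I y) p) ⟨p, v⟩).2⟩).2 = v
    rw [h1, Trivialization.apply_mk_symm _ hb]
  have h0 : (mvfderiv I (fun q ↦ ((trivializationAt E (fun y : M ↦ TangentSpace I y) p)
      ⟨q, coordField (x := p) v q⟩).2) p : E →L[ℝ] E) u = 0 := by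
    rw [mvfderiv_eq_fderiv (k := fun _ ↦ v) (mem_extChartAt_source p)
      (differentiableAt_const v) e]
    simp
  have hb := FiberBundle.mem_baseSet_trivializationAt' (F := E)
    (E := fun y : M ↦ TangentSpace I y) p
  refine (congrArg _ h0).trans ?_
  rw [← Trivialization.symmL_apply (R := ℝ) _ hb, map_zero]

variable [FiniteDimensional ℝ E]

theorem leviCivita_coordField (g : Metric I M) (p : M) (u v : E) :
    leviCivita (I' := I) g (coordField (x := p) v) p u = christoffel (I := I) (x := p) g u v := by
  exact (congrArg₂ (fun a b : E ↦ a + b) (trivializationAt_symm_mvfderiv_coordField p u v)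
    (congrArg (fun w : E ↦ (christoffel (I := I) (x := p) g u w : E))
      (coordField_self p v))).trans (zero_add _)

theorem pullbackCov_id (h : Metric I M) (p : M) (u : TangentSpace I p)
    (W : ∀ q : M, TangentSpace I q) :
    pullbackCov I h (id : M → M) W p u = leviCivita h W p u := by
  simp only [pullbackCov, leviCivita, mfderiv_id]
  rfl

theorem secondFundamentalForm_id_eq_sub (g h : Metric I M) (p : M) (u v : TangentSpace I p) :
    secondFundamentalForm g h (id : M → M) p u v
      = (leviCivita h (coordField v) p u - leviCivita g (coordField v) p u : TangentSpace I p) := by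
  have h1 : pullbackCov I h (id : M → M) (coordField v) p u = leviCivita h (coordField v) p u :=
    pullbackCov_id h p u _
  rw [← h1]
  simp only [secondFundamentalForm, mfderiv_id]
  rfl

theorem secondFundamentalForm_id (g h : Metric I M) (p : M) (u v : E) :
    secondFundamentalForm g h (id : M → M) p u v
      = christoffel (I := I) (x := p) h u v - christoffel (I := I) (x := p) g u v :=
  (secondFundamentalForm_id_eq_sub g h p u v).trans
    (congrArg₂ (fun a b : E ↦ a - b) (leviCivita_coordField h p u v)
      (leviCivita_coordField g p u v))

variable [BoundarylessManifold I M]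

theorem inner_christoffel (g : Metric I M) (p : M) (u v w : E) :
    (g.inner p : E →L[ℝ] E →L[ℝ] ℝ) (christoffel (I := I) (x := p) g u v) w
      = christoffelForm (localMetric g p) (extChartAt I p p) u v w := by
  -- Linearity in the last slot, required by `inner_sharp`, is visible only in the chart expression.
  let l : E →ₗ[ℝ] ℝ :=
    { toFun := christoffelForm (localMetric g p) (extChartAt I p p) u v
      map_add' := fun a b ↦ by simp [christoffelForm]; ring
      map_smul' := fun c a ↦ by simp [christoffelForm]; ring }
  have e : christoffel (I := I) (x := p) g u v = sharp g p l.toContinuousLinearMap := by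
    exact congrArg (sharp g p) (funext fun w ↦ christoffelLower_eq g p u v w)
  rw [e]
  exact inner_sharp (I := I) g p l.toContinuousLinearMap w

omit [FiniteDimensional ℝ E] in
theorem mvfderiv_eq_fderiv_self {f : M → ℝ} (hf : ContMDiff I 𝓘(ℝ, ℝ) ∞ f) (p : M) (w : E) :
    (mvfderiv I f p : E →L[ℝ] ℝ) w
      = fderiv ℝ (fun y ↦ f ((extChartAt I p).symm y)) (extChartAt I p p) w := by
  rw [mvfderiv_eq_fderiv (k := fun y ↦ f ((extChartAt I p).symm y)) (mem_extChartAt_source p)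
    ((contDiffAt_comp_extChartAt_symm hf p).differentiableAt (by simp)) ?_,
    tangentCoordChange_self (mem_extChartAt_source p)]
  filter_upwards [eventually_mem_extChartAt_source (I := I) p] with q hq
  rw [(extChartAt I p).left_inv hq]

omit [FiniteDimensional ℝ E] in
/-- In the preferred chart at `x`, the differential of `f` near `x` is that of its local
representation. -/
theorem eventually_fderiv_eq_mvfderiv {f : M → ℝ} (hf : ContMDiff I 𝓘(ℝ, ℝ) ∞ f) (x : M) :
    ∀ᶠ q in 𝓝 x, ∀ w : E,
      fderiv ℝ (fun y ↦ f ((extChartAt I x).symm y)) (extChartAt I x q) w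
        = (mvfderiv I f q : E →L[ℝ] ℝ) (tangentCoordChange I x q q w) := by
  have h := (contDiffAt_comp_extChartAt_symm hf x).of_le (m := 1) (by simp)
  filter_upwards [(eventually_mem_extChartAt_source (I := I) x).eventually_nhds,
    (continuousAt_extChartAt (I := I) x).eventually (h.eventually (by simp))] with q hq hd w
  rw [mvfderiv_eq_fderiv (k := fun y ↦ f ((extChartAt I x).symm y)) hq.self_of_nhds
    (hd.differentiableAt one_ne_zero) ?_, tangentCoordChange_cancel hq.self_of_nhds]
  filter_upwards [hq] with r hr
  rw [(extChartAt I x).left_inv hr]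

/-- The correction df(Γ(u,v)) equals g(grad f, Γ(u,v)), the first-kind symbol with last argument
grad f, so no index has to be raised. -/
theorem hess_eq (g : Metric I M) {f : M → ℝ} (hf : ContMDiff I 𝓘(ℝ, ℝ) ∞ f) (p : M) (u v : E) :
    hess (I := I) g f p u v = localHess (localMetric g p) (fun y ↦ f ((extChartAt I p).symm y))
      (extChartAt I p p) (grad g f p) u v := by
  have hF := contDiffAt_comp_extChartAt_symm hf p
  set F : E → ℝ := fun y ↦ f ((extChartAt I p).symm y)
  have hdF : DifferentiableAt ℝ (fderiv ℝ F) (extChartAt I p p) :=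
    ((hF.of_le (m := 2) ENat.LEInfty.out).fderiv_right (m := 1) (by norm_num)).differentiableAt
      one_ne_zero
  have h1 : (mvfderiv I (fun q ↦ mvfderiv I f q (coordField (x := p) v q)) p : E →L[ℝ] ℝ) u
      = fderiv ℝ (fderiv ℝ F) (extChartAt I p p) u v := by
    rw [mvfderiv_eq_fderiv (k := fun y ↦ fderiv ℝ F y v) (mem_extChartAt_source p)
      (hdF.clm_apply (differentiableAt_const v)) ?_,
      tangentCoordChange_self (mem_extChartAt_source p),
      (hdF.hasFDerivAt.clm_apply (hasFDerivAt_const v _)).fderiv]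
    · simp
    filter_upwards [eventually_fderiv_eq_mvfderiv hf p, eventually_mem_extChartAt_source (I := I) p]
      with q hq hs
    exact (congrArg (mvfderiv I f q : E →L[ℝ] ℝ) (coordField_eq hs v)).trans (hq v).symm
  have h2 : mvfderiv I f p (christoffel (I := I) (x := p) g u v)
      = christoffelForm (localMetric g p) (extChartAt I p p) u v (grad g f p) := by
    rw [← inner_grad g f p, g.symm]
    exact inner_christoffel g p u v (grad g f p)
  have h3 : hess (I := I) g f p u v
      = (mvfderiv I (fun q ↦ mvfderiv I f q (coordField (x := p) v q)) p : E →L[ℝ] ℝ) u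
        - mvfderiv I f p (christoffel (I := I) (x := p) g u v) :=
    congrArg (fun w : E ↦ (mvfderiv I (fun q ↦ mvfderiv I f q (coordField (x := p) v q)) p
      : E →L[ℝ] ℝ) u - (mvfderiv I f p : E →L[ℝ] ℝ) w) (leviCivita_coordField g p u v)
  exact h3.trans (congrArg₂ (· - ·) h1 h2)

end Christoffel

/-! ### Continuity of traces and Hessians in a fixed chart. -/

section MetricTraceContinuity

variable {E : Type*} [NormedAddCommGroup E] [NormedSpace ℝ E] [FiniteDimensional ℝ E]
  {ι : Type*} [Fintype ι] [DecidableEq ι]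

set_option synthInstance.maxHeartbeats 200000
set_option maxHeartbeats 800000

omit [FiniteDimensional ℝ E] in
theorem continuousAt_metricTrace (b : Module.Basis ι ℝ E) {X : Type*} [TopologicalSpace X]
    {G B : X → E →ₗ[ℝ] E →ₗ[ℝ] ℝ} {y : X}
    (hG : ∀ u v, ContinuousAt (fun z ↦ G z u v) y) (hB : ∀ u v, ContinuousAt (fun z ↦ B z u v) y)
    (hdet : (Matrix.of fun i j ↦ G y (b i) (b j)).det ≠ 0) :
    ContinuousAt (fun z ↦ metricTrace b (G z) (B z)) y := by
  simp only [metricTrace_eq_sum]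
  have hM : ContinuousAt (fun z ↦ Matrix.of fun i j ↦ G z (b i) (b j)) y :=
    continuousAt_pi.2 fun i ↦ continuousAt_pi.2 fun j ↦ hG (b i) (b j)
  have hinv : ContinuousAt (fun z ↦ (Matrix.of fun i j ↦ G z (b i) (b j))⁻¹) y := by
    refine ContinuousAt.comp (g := Inv.inv) (continuousAt_matrix_inv _ ?_) hM
    rw [Ring.inverse_eq_inv']
    exact continuousAt_inv₀ hdet
  refine tendsto_finsetSum _ fun i _ ↦ tendsto_finsetSum _ fun j _ ↦ ?_
  exact (continuousAt_pi.1 (continuousAt_pi.1 hinv i) j).mul (hB (b i) (b j))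

/-- A definite form is injective into the dual, which has equal dimension. This places `G` where
`ContinuousLinearMap.inverse` is a genuine, continuous inverse rather than its default value 0. -/
theorem exists_continuousLinearEquiv_eq {G : E →L[ℝ] E →L[ℝ] ℝ} (hG : ∀ u, G u u = 0 → u = 0) :
    ∃ e : E ≃L[ℝ] (E →L[ℝ] ℝ), (e : E →L[ℝ] E →L[ℝ] ℝ) = G := by
  have hinj : Function.Injective (G : E →ₗ[ℝ] E →L[ℝ] ℝ) := by
    rw [← LinearMap.ker_eq_bot, LinearMap.ker_eq_bot']
    intro u hu
    exact hG u (congrArg (fun L : E →L[ℝ] ℝ ↦ L u) hu)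
  have hdim : Module.finrank ℝ E = Module.finrank ℝ (E →L[ℝ] ℝ) :=
    (Subspace.dual_finrank_eq (K := ℝ) (V := E)).symm.trans
      (LinearMap.toContinuousLinearMap (𝕜 := ℝ) (E := E) (F' := ℝ)).finrank_eq
  refine ⟨(LinearMap.linearEquivOfInjective _ hinj hdim).toContinuousLinearEquiv, ?_⟩
  ext u v
  rfl

theorem continuousAt_localHess {G : E → E →L[ℝ] E →L[ℝ] ℝ} {F : E → ℝ} {y : E}
    (hG : ContDiffAt ℝ 1 G y) (hF : ContDiffAt ℝ 2 F y) (hpos : ∀ u, G y u u = 0 → u = 0)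
    (u v : E) :
    ContinuousAt (fun z ↦ localHess G F z ((G z).inverse (fderiv ℝ F z)) u v) y := by
  have hF1 : ContDiffAt ℝ 1 (fderiv ℝ F) y := hF.fderiv_right (by norm_num)
  have hF2 : ContinuousAt (fderiv ℝ (fderiv ℝ F)) y :=
    (hF1.fderiv_right (m := 0) (by norm_num)).continuousAt
  have hG1 := (hG.fderiv_right (m := 0) (by norm_num)).continuousAt
  obtain ⟨e, he⟩ := exists_continuousLinearEquiv_eq hpos
  have hinv : ContinuousAt (fun z ↦ (G z).inverse) y := by
    refine ContinuousAt.comp (g := ContinuousLinearMap.inverse) ?_ hG.continuousAt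
    rw [← he]
    exact (contDiffAt_map_inverse (n := 0) e).continuousAt
  have hs := hinv.clm_apply hF1.continuousAt
  have hc : ∀ a : E, ContinuousAt (fun _ : E ↦ a) y := fun a ↦ continuousAt_const
  simp only [localHess_apply, christoffelForm]
  exact ((hF2.clm_apply (hc u)).clm_apply (hc v)).sub (continuousAt_const.mul
    (((((hG1.clm_apply (hc u)).clm_apply (hc v)).clm_apply hs).add
      (((hG1.clm_apply (hc v)).clm_apply (hc u)).clm_apply hs)).sub
      (((hG1.clm_apply hs).clm_apply (hc u)).clm_apply (hc v))))

end MetricTraceContinuity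

/-! ### The trace of the Hessian near a point, in one chart. -/

section LocalTrace

set_option synthInstance.maxHeartbeats 200000
set_option maxHeartbeats 800000

variable {E : Type*} [NormedAddCommGroup E] [NormedSpace ℝ E] [FiniteDimensional ℝ E]
  {H : Type*} [TopologicalSpace H] {I : ModelWithCorners ℝ E H}
  {M : Type*} [TopologicalSpace M] [ChartedSpace H M] [IsManifold I ∞ M]

omit [FiniteDimensional ℝ E] in
theorem localMetric_eq_zero (g : Metric I M) {x p : M} (hp : p ∈ (extChartAt I x).source) (u : E)
    (h : localMetric g x (extChartAt I x p) u u = 0) : u = 0 := by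
  rw [localMetric_extChartAt g hp] at h
  have h0 : tangentCoordChange I x p p u = 0 := by
    by_contra hne
    exact (g.pos p _ hne).ne' h
  rw [← tangentCoordChange_cancel hp u, h0, map_zero]

/-- The local representation near `x` of `y ↦ trace_h Hess_f`. -/
def localTraceHess (g h : Metric I M) (f : M → ℝ) (x : M) (y : E) : ℝ :=
  metricTrace (Module.finBasis ℝ E) (localMetric h x y).toLinearMap₁₂
    (localHess (localMetric g x) (fun z ↦ f ((extChartAt I x).symm z)) y
      ((localMetric g x y).inverse (fderiv ℝ (fun z ↦ f ((extChartAt I x).symm z)) y)))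

variable [BoundarylessManifold I M]

theorem continuousAt_localTraceHess (g h : Metric I M) {f : M → ℝ}
    (hf : ContMDiff I 𝓘(ℝ, ℝ) ∞ f) (x : M) :
    ContinuousAt (localTraceHess g h f x) (extChartAt I x x) := by
  refine continuousAt_metricTrace _ (fun u v ↦ ?_) (continuousAt_localHess
    ((contDiffAt_localMetric g x).of_le (by simp))
    ((contDiffAt_comp_extChartAt_symm hf x).of_le ENat.LEInfty.out)
    (localMetric_eq_zero g (mem_extChartAt_source x))) ?_
  · exact ((contDiffAt_localMetric h x).continuousAt.clm_apply continuousAt_const).clm_apply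
      continuousAt_const
  · have e : (Matrix.of fun i j ↦ (localMetric h x (extChartAt I x x)).toLinearMap₁₂
        (Module.finBasis ℝ E i) (Module.finBasis ℝ E j))
        = Matrix.of fun i j ↦ h.inner x (tangentBasis I x i) (tangentBasis I x j) := by
      ext i j
      exact localMetric_extChartAt_self h x _ _
    rw [e]
    exact (isUnit_gram_det h x).ne_zero

/-- The transition map ψ from the chart at p to the chart at x pulls back both metrics, f and hence
the Hessian. At p all of them transform by the same invertible A = ψ', which the trace does not see.
-/
theorem eventually_traceMetric_hess_eq (g h : Metric I M) {f : M → ℝ}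
    (hf : ContMDiff I 𝓘(ℝ, ℝ) ∞ f) (x : M) :
    ∀ᶠ p in 𝓝 x, traceMetric h p (hess g f p) = localTraceHess g h f x (extChartAt I x p) := by
  have hcont := continuousAt_extChartAt (I := I) x
  filter_upwards [(eventually_mem_extChartAt_source (I := I) x).eventually_nhds,
    hcont.eventually (((contDiffAt_localMetric g x).of_le (m := 1) (by simp)).eventually (by simp)),
    hcont.eventually (((contDiffAt_comp_extChartAt_symm hf x).of_le (m := 2)
      ENat.LEInfty.out).eventually (by simp)),
    eventually_fderiv_eq_mvfderiv hf x] with p hp hG hF hdf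
  have hpx := hp.self_of_nhds
  have hpp := mem_extChartAt_source (I := I) p
  set A : E →L[ℝ] E := tangentCoordChange I p x p with hA
  set ψ : E → E := extChartAt I x ∘ (extChartAt I p).symm with hψdef
  set y := extChartAt I p p with hy
  have hψy : ψ y = extChartAt I x p := by simp [ψ, y]
  have hsymm := continuousAt_extChartAt_symm (I := I) p
  have hψ : ContDiffAt ℝ 2 ψ y := by
    refine (contDiffWithinAt_ext_coord_change x p ?_).contDiffAt (range_mem_nhds p)
    rw [PartialEquiv.trans_source'', PartialEquiv.symm_symm, PartialEquiv.symm_target]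
    exact Set.mem_image_of_mem _ ⟨hpp, hpx⟩
  have hsource : ∀ᶠ z in 𝓝 y, z ∈ (extChartAt I p).target ∧
      (extChartAt I p).symm z ∈ (extChartAt I x).source := by
    have h1 := hsymm.eventually (p := fun q ↦ q ∈ (extChartAt I x).source)
      (by rwa [extChartAt_to_inv])
    filter_upwards [extChartAt_target_mem_nhds_self (I := I) p, h1] with z h1 h2 using ⟨h1, h2⟩
  have hD : ∀ᶠ z in 𝓝 y, z ∈ (extChartAt I p).target ∧
      (extChartAt I p).symm z ∈ (extChartAt I x).source ∧
      fderiv ℝ ψ z = tangentCoordChange I p x ((extChartAt I p).symm z) := by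
    filter_upwards [hsource, (eventually_mem_nhds_iff.2 (range_mem_nhds (I := I) p))]
      with z hz hr
    refine ⟨hz.1, hz.2, ?_⟩
    rw [tangentCoordChange_def, (extChartAt I p).right_inv hz.1, fderivWithin_of_mem_nhds hr]
  have hAψ : fderiv ℝ ψ y = A := by
    rw [hD.self_of_nhds.2.2, hy, extChartAt_to_inv]
  have hmetric : ∀ k : Metric I M, ∀ᶠ z in 𝓝 y, ∀ a b,
      localMetric k p z a b = localMetric k x (ψ z) (fderiv ℝ ψ z a) (fderiv ℝ ψ z b) := by
    intro k
    filter_upwards [hD] with z hz a b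
    obtain ⟨h1, h2, h3⟩ := hz
    have h4 := (extChartAt I p).map_target h1
    rw [h3, localMetric_apply]
    simp only [ψ, Function.comp_apply]
    rw [localMetric_extChartAt k h2,
      tangentCoordChange_comp ⟨⟨h4, h2⟩, mem_extChartAt_source _⟩,
      tangentCoordChange_comp ⟨⟨h4, h2⟩, mem_extChartAt_source _⟩]
  have hgrad : ∀ w : E, localMetric g x (ψ y) (A (grad g f p)) w
      = fderiv ℝ (fun z ↦ f ((extChartAt I x).symm z)) (ψ y) w := by
    intro w
    rw [hψy, hdf, localMetric_extChartAt g hpx]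
    exact (congrArg (fun a : E ↦ (g.inner p : E →L[ℝ] E →L[ℝ] ℝ) a _)
      (tangentCoordChange_cancel' hpx (grad g f p))).trans (inner_grad g f p _)
  have hinverse : (localMetric g x (ψ y)).inverse
      (fderiv ℝ (fun z ↦ f ((extChartAt I x).symm z)) (ψ y)) = A (grad g f p) := by
    obtain ⟨e, he⟩ := exists_continuousLinearEquiv_eq (G := localMetric g x (ψ y))
      (by rw [hψy]; exact localMetric_eq_zero g hpx)
    have h1 : e (A (grad g f p)) = fderiv ℝ (fun z ↦ f ((extChartAt I x).symm z)) (ψ y) := by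
      ext w
      rw [← hgrad w, ← he]
      rfl
    rw [← he, ContinuousLinearMap.inverse_equiv, ← h1]
    exact e.symm_apply_apply _
  have hhess : localHess (localMetric g p) (fun z ↦ f ((extChartAt I p).symm z)) y (grad g f p)
      = (localHess (localMetric g x) (fun z ↦ f ((extChartAt I x).symm z)) (ψ y)
          (A (grad g f p))).compl₁₂ (A : E →ₗ[ℝ] E) (A : E →ₗ[ℝ] E) := by
    have := localHess_comp (F := fun z ↦ f ((extChartAt I x).symm z))
      (F' := fun z ↦ f ((extChartAt I p).symm z)) (s := (grad g f p : E))
      (by rw [hψy]; exact hG.differentiableAt one_ne_zero)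
      (differentiableAt_localMetric g p) (by rw [hψy]; exact hF) hψ (hmetric g) ?_
      (fun a b ↦ localMetric_symm g x _ a b) (by rw [hAψ]; exact hgrad)
    · rw [hAψ] at this
      exact this
    · filter_upwards [hsource] with z hz
      simp only [ψ, Function.comp_apply]
      rw [(extChartAt I x).left_inv hz.2]
  have hh : (localMetric h p y).toLinearMap₁₂
      = ((localMetric h x (ψ y)).toLinearMap₁₂).compl₁₂ (A : E →ₗ[ℝ] E) (A : E →ₗ[ℝ] E) := by
    ext u v
    have := (hmetric h).self_of_nhds u v
    rw [hAψ] at this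
    exact this
  have hunit : IsUnit (A : E →ₗ[ℝ] E) := by
    rw [LinearMap.isUnit_iff_ker_eq_bot, LinearMap.ker_eq_bot']
    intro u hu
    rw [← tangentCoordChange_cancel' hpx u]
    exact (congrArg (tangentCoordChange I x p p) hu).trans (map_zero _)
  rw [localTraceHess, ← hψy, hinverse, ← metricTrace_compl₁₂ _ _ _ hunit, ← hh, ← hhess,
    metricTrace_eq_sum]
  refine Finset.sum_congr rfl fun i _ ↦ Finset.sum_congr rfl fun j _ ↦
    congrArg₂ (· * ·) ?_ (hess_eq g hf p _ _)
  have e : (Matrix.of fun i j ↦ h.inner p (tangentBasis I p i) (tangentBasis I p j))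
      = Matrix.of fun i j ↦ (localMetric h p y).toLinearMap₁₂
        (Module.finBasis ℝ E i) (Module.finBasis ℝ E j) := by
    ext i j
    exact (localMetric_extChartAt_self h p _ _).symm
  rw [gramInv, e]

end LocalTrace

/-! ### The deformed metric: sharp, trace, connection and tension field. -/

section DeformedConnection

set_option synthInstance.maxHeartbeats 200000
set_option maxHeartbeats 800000

variable {E : Type*} [NormedAddCommGroup E] [NormedSpace ℝ E] [FiniteDimensional ℝ E]
  {H : Type*} [TopologicalSpace H] {I : ModelWithCorners ℝ E H}
  {M : Type*} [TopologicalSpace M] [ChartedSpace H M] [IsManifold I ∞ M]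

omit [FiniteDimensional ℝ E] [IsManifold I ∞ M] in
theorem tendsto_extChartAt_symm (x : M) :
    Filter.Tendsto (extChartAt I x).symm (𝓝 (extChartAt I x x)) (𝓝 x) := by
  have h := continuousAt_extChartAt_symm (I := I) x
  rwa [ContinuousAt, extChartAt_to_inv] at h

omit [FiniteDimensional ℝ E] in
theorem eq_of_inner_eq (g : Metric I M) {x : M} {a b : TangentSpace I x}
    (h : ∀ w, g.inner x a w = g.inner x b w) : a = b := by
  rw [← sub_eq_zero]
  by_contra hne
  refine (g.pos x _ hne).ne' ?_
  have h0 : g.inner x (a - b) = 0 := by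
    rw [map_sub, sub_eq_zero]
    exact ContinuousLinearMap.ext h
  rw [h0]
  rfl

/-- The Sherman–Morrison formula for the rank-one perturbation g - df ⊗ df, verified by pairing with
an arbitrary vector. -/
theorem sharp_deformedMetric (g : Metric I M) {f : M → ℝ} (hf : ContMDiff I 𝓘(ℝ, ℝ) ∞ f)
    (hgrad : ∀ x, gradNormSq g f x < 1) (x : M) (l : TangentSpace I x →L[ℝ] ℝ) :
    sharp (deformedMetric g f hf hgrad) x l
      = sharp g x l + (l (grad g f x) / (1 - gradNormSq g f x)) • grad g f x := by
  have hne : 1 - gradNormSq g f x ≠ 0 := (sub_pos.2 (hgrad x)).ne'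
  refine eq_of_inner_eq (deformedMetric g f hf hgrad) fun w ↦ ?_
  rw [inner_sharp]
  change _ = deformedInner g f x _ w
  have h1 : mvfderiv I f x (sharp g x l) = l (grad g f x) := by
    rw [← inner_grad g f x, g.symm, inner_sharp]
  have h2 : mvfderiv I f x (grad g f x) = gradNormSq g f x := (inner_grad g f x _).symm
  rw [deformedInner_apply, map_add, map_add, map_smul, map_smul, add_apply, smul_apply,
    inner_sharp, inner_grad, h1, h2]
  simp only [smul_eq_mul]
  field_simp
  ring

/-- Expressing the trace through the sharps of the dual basis lets the formula for the deformed
sharp replace any computation with inverse Gram matrices. -/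
theorem traceMetric_eq_sum_sharp (g : Metric I M) (x : M)
    (B : TangentSpace I x →ₗ[ℝ] TangentSpace I x →ₗ[ℝ] ℝ) :
    traceMetric g x (fun u v ↦ B u v)
      = ∑ i, B (tangentBasis I x i) (sharp g x ((tangentBasis I x).coord i)) := by
  have e : ∀ i, sharp g x ((tangentBasis I x).coord i)
      = ∑ j, gramInv g x i j • tangentBasis I x j := by
    intro i
    rw [sharp, Finset.sum_eq_single i (fun k _ hk ↦ by simp [hk]) (by simp)]
    simp
  simp only [traceMetric, e, map_sum, map_smul]

theorem traceMetric_deformedMetric (g : Metric I M) {f : M → ℝ} (hf : ContMDiff I 𝓘(ℝ, ℝ) ∞ f)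
    (hgrad : ∀ x, gradNormSq g f x < 1) (x : M)
    (B : TangentSpace I x →ₗ[ℝ] TangentSpace I x →ₗ[ℝ] ℝ) :
    traceMetric (deformedMetric g f hf hgrad) x (fun u v ↦ B u v)
      = traceMetric g x (fun u v ↦ B u v)
        + B (grad g f x) (grad g f x) / (1 - gradNormSq g f x) := by
  have hs : ∀ i, sharp (deformedMetric g f hf hgrad) x ((tangentBasis I x).coord i)
      = sharp g x ((tangentBasis I x).coord i)
        + ((tangentBasis I x).repr (grad g f x) i / (1 - gradNormSq g f x)) • grad g f x := by
    intro i
    let l : E →L[ℝ] ℝ := LinearMap.toContinuousLinearMap (E := E) ((tangentBasis I x).coord i)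
    exact sharp_deformedMetric g hf hgrad x l
  rw [traceMetric_eq_sum_sharp, traceMetric_eq_sum_sharp]
  simp only [hs, map_add, map_smul, Finset.sum_add_distrib, add_right_inj]
  have e : B (grad g f x) (grad g f x) = ∑ i, (tangentBasis I x).repr (grad g f x) i
      * B (tangentBasis I x i) (grad g f x) := by
    have h := congrArg (fun w ↦ B w (grad g f x)) ((tangentBasis I x).sum_repr (grad g f x))
    simp only [map_sum, map_smul, LinearMap.sum_apply, LinearMap.smul_apply, smul_eq_mul] at h
    exact h.symm
  rw [e, Finset.sum_div]
  exact Finset.sum_congr rfl fun i _ ↦ by rw [smul_eq_mul]; ring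

variable [BoundarylessManifold I M]

omit [FiniteDimensional ℝ E] in
theorem eventually_fderiv_comp_extChartAt_symm_eq {f : M → ℝ} (hf : ContMDiff I 𝓘(ℝ, ℝ) ∞ f)
    (x : M) :
    ∀ᶠ y in 𝓝 (extChartAt I x x), ∀ w : E,
      fderiv ℝ (fun z ↦ f ((extChartAt I x).symm z)) y w
        = (mvfderiv I f ((extChartAt I x).symm y) : E →L[ℝ] ℝ)
          (tangentCoordChange I x ((extChartAt I x).symm y) ((extChartAt I x).symm y) w) := by
  filter_upwards [(tendsto_extChartAt_symm (I := I) x).eventually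
    (eventually_fderiv_eq_mvfderiv hf x), extChartAt_target_mem_nhds_self (I := I) x] with y hy ht w
  rw [← hy w, (extChartAt I x).right_inv ht]

theorem eventually_localMetric_deformedMetric (g : Metric I M) {f : M → ℝ}
    (hf : ContMDiff I 𝓘(ℝ, ℝ) ∞ f) (hgrad : ∀ x, gradNormSq g f x < 1) (x : M) :
    ∀ᶠ y in 𝓝 (extChartAt I x x), ∀ a b,
      localMetric (deformedMetric g f hf hgrad) x y a b = localMetric g x y a b
        - fderiv ℝ (fun z ↦ f ((extChartAt I x).symm z)) y a
          * fderiv ℝ (fun z ↦ f ((extChartAt I x).symm z)) y b := by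
  filter_upwards [eventually_fderiv_comp_extChartAt_symm_eq hf x] with y hy a b
  rw [hy, hy]
  exact deformedInner_apply g f _ _ _

/-- Pair with w under g̃. Since g̃(grad f, w) = (1 - ‖grad f‖²) df(w), the right side gives Γ(u,v,w)
- (df(Γ(u,v)) + Hess_f(u,v)) df(w), and the bracket is the coordinate second derivative of f. -/
theorem christoffel_deformedMetric (g : Metric I M) {f : M → ℝ} (hf : ContMDiff I 𝓘(ℝ, ℝ) ∞ f)
    (hgrad : ∀ x, gradNormSq g f x < 1) (x : M) (u v : TangentSpace I x) :
    christoffel (deformedMetric g f hf hgrad) u v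
      = christoffel g u v - (hess g f x u v / (1 - gradNormSq g f x)) • grad g f x := by
  have hne : 1 - gradNormSq g f x ≠ 0 := (sub_pos.2 (hgrad x)).ne'
  refine eq_of_inner_eq (deformedMetric g f hf hgrad) fun w ↦ ?_
  refine (inner_christoffel (deformedMetric g f hf hgrad) x u v w).trans ?_
  rw [christoffelForm_sub_fderiv_mul_fderiv (differentiableAt_localMetric g x)
    (differentiableAt_localMetric _ x)
    ((contDiffAt_comp_extChartAt_symm hf x).of_le ENat.LEInfty.out)
    (eventually_localMetric_deformedMetric g hf hgrad x) u v w]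
  change _ = deformedInner g f x _ w
  have h1 : g.inner x (christoffel g u v) w = _ := inner_christoffel g x u v w
  have h2 : mvfderiv I f x (grad g f x) = gradNormSq g f x := (inner_grad g f x _).symm
  have h3 : mvfderiv I f x (christoffel g u v) = _ :=
    (inner_grad g f x _).symm.trans ((g.symm _ _ _).trans
      (inner_christoffel g x u v (grad g f x)))
  have h4 := (hess_eq g hf x u v).trans (localHess_apply _ _ _ _ _ _)
  have h5 : mvfderiv I f x w = _ := mvfderiv_eq_fderiv_self hf x w
  rw [deformedInner_apply, map_sub, map_sub, map_smul, map_smul, sub_apply, smul_apply,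
    inner_grad, h1, h2, h3, h4, h5]
  simp only [smul_eq_mul]
  field_simp
  ring

theorem tensionField_deformedMetric_id (g : Metric I M) {f : M → ℝ}
    (hf : ContMDiff I 𝓘(ℝ, ℝ) ∞ f) (hgrad : ∀ x, gradNormSq g f x < 1) (x : M) :
    tensionField (deformedMetric g f hf hgrad) g (id : M → M) x
      = (traceMetric (deformedMetric g f hf hgrad) x (hess g f x) / (1 - gradNormSq g f x))
        • grad g f x := by
  have h : ∀ u v, secondFundamentalForm (deformedMetric g f hf hgrad) g (id : M → M) x u v
      = ((hess g f x u v / (1 - gradNormSq g f x)) • grad g f x : TangentSpace I x) := by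
    intro u v
    refine (secondFundamentalForm_id (deformedMetric g f hf hgrad) g x u v).trans ?_
    exact (congrArg (fun a : TangentSpace I x ↦ christoffel g u v - a)
      (christoffel_deformedMetric g hf hgrad x u v)).trans (sub_sub_cancel _ _)
  have h' : secondFundamentalForm (deformedMetric g f hf hgrad) g (id : M → M) x
      = fun u v ↦ ((hess g f x u v / (1 - gradNormSq g f x)) • grad g f x : TangentSpace I x) :=
    funext fun u ↦ funext fun v ↦ h u v
  have h3 : tensionField (deformedMetric g f hf hgrad) g (id : M → M) x
      = traceMetric (deformedMetric g f hf hgrad) x (fun u v ↦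
        ((hess g f x u v / (1 - gradNormSq g f x)) • grad g f x : TangentSpace I x)) :=
    congrArg (traceMetric (deformedMetric g f hf hgrad) x) h'
  rw [h3, traceMetric, traceMetric, Finset.sum_div, Finset.sum_smul]
  refine Finset.sum_congr rfl fun i _ ↦ ?_
  rw [Finset.sum_div, Finset.sum_smul]
  refine Finset.sum_congr rfl fun j _ ↦ ?_
  rw [smul_smul, smul_eq_mul, mul_div_assoc]

theorem traceMetric_deformedMetric_hess (g : Metric I M) {f : M → ℝ}
    (hf : ContMDiff I 𝓘(ℝ, ℝ) ∞ f) (hgrad : ∀ x, gradNormSq g f x < 1) (x : M) :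
    traceMetric (deformedMetric g f hf hgrad) x (hess g f x)
      = laplacian g f x + hess g f x (grad g f x) (grad g f x) / (1 - gradNormSq g f x) := by
  -- Bilinearity of `hess` is not apparent from its definition; the chart expression supplies it.
  let B : TangentSpace I x →ₗ[ℝ] TangentSpace I x →ₗ[ℝ] ℝ :=
    localHess (E := E) (localMetric g x) (fun y ↦ f ((extChartAt I x).symm y))
      (extChartAt I x x) (grad g f x)
  have hB : hess g f x = fun u v ↦ B u v :=
    funext fun u ↦ funext fun v ↦ hess_eq g hf x u v
  rw [laplacian, hB]
  exact traceMetric_deformedMetric g hf hgrad x B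

/-- If the identity map from the deformed to the original metric is harmonic, the trace of the
Hessian vanishes also at critical points of `f`. -/
theorem traceMetric_hess_eq_zero_of_isHarmonicMap (g : Metric I M) {f : M → ℝ}
    (hf : ContMDiff I 𝓘(ℝ, ℝ) ∞ f) (hgrad : ∀ x, gradNormSq g f x < 1)
    (h : IsHarmonicMap (deformedMetric g f hf hgrad) g (id : M → M)) (x : M) :
    traceMetric (deformedMetric g f hf hgrad) x (hess g f x) = 0 := by
  by_contra hx
  have heq := eventually_traceMetric_hess_eq g (deformedMetric g f hf hgrad) hf x
  have hcont := (continuousAt_localTraceHess g (deformedMetric g f hf hgrad) hf x).comp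
    (continuousAt_extChartAt (I := I) x)
  rw [heq.self_of_nhds] at hx
  -- Where the trace is nonzero, the coefficient of grad f in the tension field is nonzero, so
  -- harmonicity forces grad f = 0.
  have hdf : ∀ᶠ p in 𝓝 x, grad g f p = 0 := by
    filter_upwards [heq, hcont.eventually_ne hx] with p hp hp0
    have ht := (tensionField_deformedMetric_id g hf hgrad p).symm.trans (h.2 p)
    refine (smul_eq_zero.1 ht).resolve_left (div_ne_zero ?_ (sub_pos.2 (hgrad p)).ne')
    rwa [hp]
  set F : E → ℝ := fun y ↦ f ((extChartAt I x).symm y)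
  have hF0 : fderiv ℝ F =ᶠ[𝓝 (extChartAt I x x)] fun _ ↦ 0 := by
    filter_upwards [(tendsto_extChartAt_symm (I := I) x).eventually hdf,
      eventually_fderiv_comp_extChartAt_symm_eq hf x] with y h2 h3
    ext w
    rw [h3 w]
    refine (inner_grad g f _ _).symm.trans ?_
    rw [h2, map_zero]
    rfl
  have hh : ∀ u v, hess g f x u v = 0 := by
    intro u v
    have h0 : ∀ a b : E, localHess (localMetric g x) F (extChartAt I x x) 0 a b = 0 := by
      intro a b
      rw [localHess_apply, hF0.fderiv_eq]
      simp [christoffelForm]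
    exact (hess_eq g hf x u v).trans ((congrArg (fun s : E ↦
      localHess (localMetric g x) F (extChartAt I x x) s u v) hdf.self_of_nhds).trans (h0 u v))
  rw [← heq.self_of_nhds] at hx
  apply hx
  simp [traceMetric, hh]

end DeformedConnection

end RiemHarmonic

end

theorem theorem2
    {E : Type*} [NormedAddCommGroup E] [NormedSpace ℝ E] [FiniteDimensional ℝ E]
    {H : Type*} [TopologicalSpace H] {I : ModelWithCorners ℝ E H}
    {M : Type*} [TopologicalSpace M] [ChartedSpace H M] [IsManifold I ∞ M]
    [BoundarylessManifold I M]
    (g : RiemHarmonic.Metric I M) (f : M → ℝ) (hf : ContMDiff I 𝓘(ℝ, ℝ) ∞ f)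
    (hgrad : ∀ x, RiemHarmonic.gradNormSq g f x < 1) :
    (∀ x : M,
      RiemHarmonic.tensionField (RiemHarmonic.deformedMetric g f hf hgrad) g (id : M → M) x =
        (RiemHarmonic.hess g f x (RiemHarmonic.grad g f x) (RiemHarmonic.grad g f x)
              / (1 - RiemHarmonic.gradNormSq g f x) ^ 2
            + RiemHarmonic.laplacian g f x / (1 - RiemHarmonic.gradNormSq g f x))
          • RiemHarmonic.grad g f x) ∧
    (RiemHarmonic.IsHarmonicMap (RiemHarmonic.deformedMetric g f hf hgrad) g (id : M → M) ↔
      ∀ x : M,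
        RiemHarmonic.hess g f x (RiemHarmonic.grad g f x) (RiemHarmonic.grad g f x)
          + (1 - RiemHarmonic.gradNormSq g f x) * RiemHarmonic.laplacian g f x = 0) := by
  -- The equation is the vanishing of the deformed trace, multiplied by the nonzero factor 1 - ‖grad
  -- f‖².
  have key : ∀ x : M, RiemHarmonic.hess g f x (RiemHarmonic.grad g f x) (RiemHarmonic.grad g f x)
        + (1 - RiemHarmonic.gradNormSq g f x) * RiemHarmonic.laplacian g f x
      = (1 - RiemHarmonic.gradNormSq g f x) * RiemHarmonic.traceMetric
        (RiemHarmonic.deformedMetric g f hf hgrad) x (RiemHarmonic.hess g f x) := by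
    intro x
    have hne : 1 - RiemHarmonic.gradNormSq g f x ≠ 0 := (sub_pos.2 (hgrad x)).ne'
    rw [RiemHarmonic.traceMetric_deformedMetric_hess]
    field_simp
    ring
  refine ⟨fun x ↦ ?_, fun h x ↦ ?_, fun h ↦ ⟨contMDiff_id, fun x ↦ ?_⟩⟩
  · have hne : 1 - RiemHarmonic.gradNormSq g f x ≠ 0 := (sub_pos.2 (hgrad x)).ne'
    refine (RiemHarmonic.tensionField_deformedMetric_id g hf hgrad x).trans ?_
    rw [RiemHarmonic.traceMetric_deformedMetric_hess]
    refine congrArg (fun c : ℝ ↦ c • RiemHarmonic.grad g f x) ?_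
    field_simp
    ring
  · rw [key, RiemHarmonic.traceMetric_hess_eq_zero_of_isHarmonicMap g hf hgrad h x, mul_zero]
  · have hne : 1 - RiemHarmonic.gradNormSq g f x ≠ 0 := (sub_pos.2 (hgrad x)).ne'
    refine (RiemHarmonic.tensionField_deformedMetric_id g hf hgrad x).trans ?_
    have h0 := h x
    rw [key, mul_eq_zero, or_iff_right hne] at h0
    rw [h0, zero_div]
    exact zero_smul ℝ (RiemHarmonic.grad g f x)
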